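/- Let $X$ be a real Banach space with closed unit ball $B_X$. Assume that $X$ contains a complemented copy of $\ell_1$, that is, there is a linear subspace $Y\subseteq X$ which is linearly homeomorphic to $\ell_1$ (the space of absolutely summable real sequences with the norm $\sum_j|t_j|$) and which is the range of a bounded linear projection $P\colon X\to Y$. Then for every $\alpha\in(0,1)$ there is a mapping $T\colon B_X\to B_X$ such that 1. $T$ is uniformly $\alpha$-Hölder nonexpansive: $\|T^n x-T^n y\|\le \|x-y\|^{\alpha}$ for all $x,y\in B_X$ and all $n\in\{1,2,3,\dots\}$; 2. $T$ has no fixed point in $B_X$; 3. the minimal displacement of $T$ is zero: $\mathrm{d}(T,B_X):=\inf_{x\in B_X}\|x-Tx\|=0$. -/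

import Mathlib

/-- The real Banach space `X` contains a complemented copy of `ℓ₁`: some linear subspace `Y` of `X`
is linearly homeomorphic to `ℓ₁` (an isomorphic, not necessarily isometric, copy) and is the range
of a continuous linear projection defined on all of `X`. -/
def ContainsComplementedEllOne (X : Type*) [NormedAddCommGroup X] [NormedSpace ℝ X] : Prop :=
  ∃ Y : Submodule ℝ X,
    Y.ClosedComplemented ∧ Nonempty (Y ≃L[ℝ] lp (fun _ : ℕ => ℝ) 1)

/-- A self-map `T` of a metric space is uniformly `α`-Hölder nonexpansive if
`ρ(Tⁿ x, Tⁿ y) ≤ ρ(x, y) ^ α` for all `x, y` and all `n = 1, 2, 3, …`. -/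
def UniformlyHolderNonexpansive {K : Type*} [MetricSpace K] (α : ℝ) (T : K → K) : Prop :=
  ∀ n : ℕ, 1 ≤ n → ∀ x y : K, dist (T^[n] x) (T^[n] y) ≤ dist x y ^ α

/-- The minimal displacement `d(T, K) = inf_{x ∈ K} ρ(x, T x)` of a self-map `T` of a (nonempty)
metric space `K`. -/
noncomputable def minimalDisplacement {K : Type*} [MetricSpace K] (T : K → K) : ℝ :=
  ⨅ x : K, dist x (T x)

/-! On the unit sphere of `ℓ₁` the right shift is an isometry without fixed points, yet it nearly
fixes normalized blocks of ones. `sphereShift` extends it to all of `ℓ₁` with values in the sphere,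
so every iterate after the first is an isometric shift and all iterates share the Lipschitz constant
4. A left-invertible embedding `e`, with left inverse `Q`, carries this map to `X`, scaled by a
small `c`. Scaling leaves the Lipschitz bound `‖e‖ * 4 * ‖Q‖` unchanged but shrinks the diameter of
the image, and on a set of small diameter a Lipschitz bound gives the Hölder bound with constant 1
(`le_rpow_of_le_mul_of_le`). -/

/-- The sequence `(a, u 0, u 1, …)` as an element of `ℓ₁`. -/
def ellOneCons (a : ℝ) (u : lp (fun _ : ℕ => ℝ) 1) : lp (fun _ : ℕ => ℝ) 1 :=
  ⟨fun n => Nat.casesOn n a u, by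
    have hu : Summable fun n => ‖u n‖ := by simpa using (lp.memℓp u).summable (by simp)
    refine memℓp_gen ?_
    simp only [ENNReal.toReal_one, Real.rpow_one]
    exact (summable_nat_add_iff 1).1 (by simpa using hu)⟩

@[simp]
theorem ellOneCons_zero (a : ℝ) (u : lp (fun _ : ℕ => ℝ) 1) : ellOneCons a u 0 = a := rfl

@[simp]
theorem ellOneCons_succ (a : ℝ) (u : lp (fun _ : ℕ => ℝ) 1) (n : ℕ) :
    ellOneCons a u (n + 1) = u n := rfl

theorem ellOneCons_sub (a b : ℝ) (u v : lp (fun _ : ℕ => ℝ) 1) :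
    ellOneCons a u - ellOneCons b v = ellOneCons (a - b) (u - v) := by
  ext n
  cases n <;> simp

theorem smul_ellOneCons (r a : ℝ) (u : lp (fun _ : ℕ => ℝ) 1) :
    r • ellOneCons a u = ellOneCons (r * a) (r • u) := by
  ext n
  cases n <;> simp

theorem ellOne_norm_eq (u : lp (fun _ : ℕ => ℝ) 1) : ‖u‖ = ∑' n, ‖u n‖ := by
  simpa using lp.norm_eq_tsum_rpow (by simp) u

theorem norm_ellOneCons (a : ℝ) (u : lp (fun _ : ℕ => ℝ) 1) :
    ‖ellOneCons a u‖ = |a| + ‖u‖ := by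
  have hs : Summable fun n => ‖ellOneCons a u n‖ := by
    simpa using (lp.memℓp (ellOneCons a u)).summable (by simp)
  rw [ellOne_norm_eq, ellOne_norm_eq, hs.tsum_eq_zero_add]
  simp

theorem ellOneCons_zero_eq_self {w : lp (fun _ : ℕ => ℝ) 1} (h : ellOneCons 0 w = w) :
    w = 0 := by
  ext n
  induction n with
  | zero => rw [← h]; rfl
  | succ n ih => rw [← h, ellOneCons_succ, ih]; rfl

/-- The radial retraction of a normed space onto its closed unit ball. -/
noncomputable def radialRetraction {E : Type*} [NormedAddCommGroup E] [NormedSpace ℝ E]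
    (u : E) : E := (max 1 ‖u‖)⁻¹ • u

section radialRetraction

variable {E : Type*} [NormedAddCommGroup E] [NormedSpace ℝ E]

theorem norm_radialRetraction_le (u : E) : ‖radialRetraction u‖ ≤ 1 := by
  have h : 0 < max 1 ‖u‖ := lt_max_of_lt_left one_pos
  rw [radialRetraction, norm_smul, norm_inv, Real.norm_of_nonneg h.le, inv_mul_le_iff₀ h, mul_one]
  exact le_max_right _ _

theorem radialRetraction_of_norm_le {u : E} (h : ‖u‖ ≤ 1) : radialRetraction u = u := by
  simp [radialRetraction, max_eq_left h]

theorem norm_radialRetraction_sub_le (u v : E) :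
    ‖radialRetraction u - radialRetraction v‖ ≤ 2 * ‖u - v‖ := by
  have hu : 1 ≤ max 1 ‖u‖ := le_max_left _ _
  have hu0 : max 1 ‖u‖ ≠ 0 := (zero_lt_one.trans_le hu).ne'
  have hv0 : max 1 ‖v‖ ≠ 0 := (zero_lt_one.trans_le (le_max_left _ _)).ne'
  have hinv : (max 1 ‖u‖)⁻¹ ≤ 1 := inv_le_one_of_one_le₀ hu
  -- Splits the error into a change of vector and a change of radius, each at most `‖u - v‖`.
  have key : radialRetraction u - radialRetraction v = (max 1 ‖u‖)⁻¹ •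
      ((u - v) + (max 1 ‖v‖ - max 1 ‖u‖) • radialRetraction v) := by
    simp only [radialRetraction]
    match_scalars <;> field_simp
    ring
  have hmax : |max 1 ‖v‖ - max 1 ‖u‖| ≤ ‖u - v‖ := by
    rw [max_comm 1, max_comm 1, norm_sub_rev]
    exact (abs_max_sub_max_le_abs _ _ _).trans (abs_norm_sub_norm_le v u)
  rw [key, norm_smul, norm_inv, Real.norm_of_nonneg (zero_le_one.trans hu)]
  calc (max 1 ‖u‖)⁻¹ * ‖(u - v) + (max 1 ‖v‖ - max 1 ‖u‖) • radialRetraction v‖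
      ≤ 1 * (‖u - v‖ + ‖u - v‖ * 1) := by
        refine mul_le_mul hinv ((norm_add_le _ _).trans ?_) (norm_nonneg _) zero_le_one
        rw [norm_smul, Real.norm_eq_abs]
        gcongr
        exact norm_radialRetraction_le v
    _ = 2 * ‖u - v‖ := by ring

end radialRetraction

/-- A Lipschitz map of `ℓ₁` into its unit sphere which restricts to the right shift there. -/
noncomputable def sphereShift (u : lp (fun _ : ℕ => ℝ) 1) : lp (fun _ : ℕ => ℝ) 1 :=
  ellOneCons (1 - ‖radialRetraction u‖) (radialRetraction u)

theorem norm_sphereShift (u : lp (fun _ : ℕ => ℝ) 1) : ‖sphereShift u‖ = 1 := by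
  rw [sphereShift, norm_ellOneCons, abs_of_nonneg (sub_nonneg.2 (norm_radialRetraction_le u))]
  ring

theorem sphereShift_of_norm_eq_one {w : lp (fun _ : ℕ => ℝ) 1} (h : ‖w‖ = 1) :
    sphereShift w = ellOneCons 0 w := by
  rw [sphereShift, radialRetraction_of_norm_le h.le, h, sub_self]

/-- The 2-Lipschitz retraction enters twice: in the tail and, through its norm, in the first
coordinate. -/
theorem norm_sphereShift_sub_le (u v : lp (fun _ : ℕ => ℝ) 1) :
    ‖sphereShift u - sphereShift v‖ ≤ 4 * ‖u - v‖ := by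
  have h := norm_radialRetraction_sub_le u v
  have h' := abs_norm_sub_norm_le (radialRetraction v) (radialRetraction u)
  rw [norm_sub_rev] at h'
  rw [sphereShift, sphereShift, ellOneCons_sub, norm_ellOneCons, sub_sub_sub_cancel_left]
  linarith

theorem norm_iterate_sphereShift (n : ℕ) (u : lp (fun _ : ℕ => ℝ) 1) :
    ‖sphereShift^[n + 1] u‖ = 1 := by
  rw [Function.iterate_succ_apply', norm_sphereShift]

theorem norm_iterate_sphereShift_sub_le (n : ℕ) (u v : lp (fun _ : ℕ => ℝ) 1) :
    ‖sphereShift^[n + 1] u - sphereShift^[n + 1] v‖ ≤ 4 * ‖u - v‖ := by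
  induction n with
  | zero => exact norm_sphereShift_sub_le u v
  | succ n ih =>
    rw [Function.iterate_succ_apply' _ (n + 1), Function.iterate_succ_apply' _ (n + 1),
      sphereShift_of_norm_eq_one (norm_iterate_sphereShift n u),
      sphereShift_of_norm_eq_one (norm_iterate_sphereShift n v), ellOneCons_sub, norm_ellOneCons]
    simpa using ih

theorem sphereShift_ne_self (w : lp (fun _ : ℕ => ℝ) 1) : sphereShift w ≠ w := by
  intro h
  have hw : ‖w‖ = 1 := h ▸ norm_sphereShift w
  rw [sphereShift_of_norm_eq_one hw] at h
  simp [ellOneCons_zero_eq_self h] at hw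

/-- The sequence `(1, …, 1, 0, 0, …)` with `N` ones. -/
noncomputable def ellOneOnes (N : ℕ) : lp (fun _ : ℕ => ℝ) 1 := (ellOneCons 1)^[N] 0

theorem ellOneOnes_succ (N : ℕ) : ellOneOnes (N + 1) = ellOneCons 1 (ellOneOnes N) :=
  Function.iterate_succ_apply' _ _ _

theorem norm_ellOneOnes (N : ℕ) : ‖ellOneOnes N‖ = N := by
  induction N with
  | zero => simp [ellOneOnes]
  | succ N ih => rw [ellOneOnes_succ, norm_ellOneCons, ih, abs_one]; push_cast; ring

theorem norm_ellOneCons_one_ellOneOnes_sub (N : ℕ) :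
    ‖ellOneCons 1 (ellOneOnes N) - ellOneOnes N‖ = 1 := by
  induction N with
  | zero => simp [ellOneOnes, norm_ellOneCons]
  | succ N ih =>
    rw [ellOneOnes_succ, ellOneCons_sub, norm_ellOneCons, ih]
    simp

theorem norm_ellOneCons_zero_ellOneOnes_sub (N : ℕ) :
    ‖ellOneCons 0 (ellOneOnes (N + 1)) - ellOneOnes (N + 1)‖ = 2 := by
  rw [ellOneOnes_succ, ellOneCons_sub, norm_ellOneCons, norm_ellOneCons_one_ellOneOnes_sub]
  norm_num

theorem exists_norm_sphereShift_sub_le {ε : ℝ} (hε : 0 < ε) :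
    ∃ w : lp (fun _ : ℕ => ℝ) 1, ‖w‖ = 1 ∧ ‖sphereShift w - w‖ ≤ ε := by
  obtain ⟨N, hN⟩ := exists_nat_gt (2 / ε)
  have hpos : (0 : ℝ) < (N + 1 : ℕ) := by positivity
  have hw : ‖((N + 1 : ℕ) : ℝ)⁻¹ • ellOneOnes (N + 1)‖ = 1 := by
    rw [norm_smul, norm_ellOneOnes, norm_inv, Real.norm_of_nonneg hpos.le,
      inv_mul_cancel₀ hpos.ne']
  refine ⟨_, hw, ?_⟩
  have hcons : ellOneCons 0 (((N + 1 : ℕ) : ℝ)⁻¹ • ellOneOnes (N + 1)) =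
      ((N + 1 : ℕ) : ℝ)⁻¹ • ellOneCons 0 (ellOneOnes (N + 1)) := by
    rw [smul_ellOneCons, mul_zero]
  rw [sphereShift_of_norm_eq_one hw, hcons, ← smul_sub, norm_smul,
    norm_ellOneCons_zero_ellOneOnes_sub, norm_inv, Real.norm_of_nonneg hpos.le,
    inv_mul_le_iff₀ hpos]
  rw [div_lt_iff₀ hε] at hN
  push_cast
  nlinarith

/-- Interpolation: in `t = t ^ α * t ^ (1 - α)`, bound the first factor by the Lipschitz estimate
and the second by the diameter. -/
theorem le_rpow_of_le_mul_of_le {α t d L δ : ℝ} (hα : α ∈ Set.Ioo (0 : ℝ) 1) (ht : 0 ≤ t)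
    (hd : 0 ≤ d) (hL : 0 ≤ L) (htd : t ≤ L * d) (htδ : t ≤ δ)
    (hδ : L ^ α * δ ^ (1 - α) ≤ 1) : t ≤ d ^ α := by
  have h1 : 0 ≤ 1 - α := sub_nonneg.2 hα.2.le
  calc t = t ^ α * t ^ (1 - α) := by
        rw [← Real.rpow_add_of_nonneg ht hα.1.le h1, add_sub_cancel, Real.rpow_one]
    _ ≤ (L * d) ^ α * δ ^ (1 - α) := by
        gcongr
        exact hα.1.le
    _ = (L ^ α * δ ^ (1 - α)) * d ^ α := by rw [Real.mul_rpow hL hd]; ring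
    _ ≤ d ^ α := mul_le_of_le_one_left (by positivity) hδ

theorem exists_pos_rpow_mul_rpow_le_one {α L : ℝ} (hα : α ∈ Set.Ioo (0 : ℝ) 1) (hL : 0 ≤ L) :
    ∃ δ : ℝ, 0 < δ ∧ δ ≤ 1 ∧ L ^ α * δ ^ (1 - α) ≤ 1 := by
  have h1 : 0 < 1 - α := sub_pos.2 hα.2
  have hM : 0 < L + 1 := by positivity
  -- Solves `(L + 1) ^ α * δ ^ (1 - α) = 1`; using `L + 1 ≥ 1` gives `δ ≤ 1` and covers `L = 0`.
  refine ⟨(L + 1) ^ (-(α / (1 - α))), by positivity, ?_, ?_⟩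
  · exact Real.rpow_le_one_of_one_le_of_nonpos (by linarith)
      (neg_nonpos.2 (div_nonneg hα.1.le h1.le))
  · rw [← Real.rpow_mul hM.le, neg_mul, div_mul_cancel₀ _ h1.ne', Real.rpow_neg hM.le,
      ← div_eq_mul_inv, div_le_one (by positivity)]
    exact Real.rpow_le_rpow hL (by linarith) hα.1.le

theorem ContainsComplementedEllOne.exists_leftInverse {X : Type*} [NormedAddCommGroup X]
    [NormedSpace ℝ X] (hX : ContainsComplementedEllOne X) :
    ∃ (e : lp (fun _ : ℕ => ℝ) 1 →L[ℝ] X) (Q : X →L[ℝ] lp (fun _ : ℕ => ℝ) 1),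
      ∀ u, Q (e u) = u := by
  obtain ⟨Y, ⟨P, hP⟩, ⟨φ⟩⟩ := hX
  refine ⟨Y.subtypeL.comp φ.symm.toContinuousLinearMap, φ.toContinuousLinearMap.comp P, ?_⟩
  intro u
  simp [hP]

theorem proposition5p4 {X : Type*} [NormedAddCommGroup X] [NormedSpace ℝ X] [CompleteSpace X]
    (hX : ContainsComplementedEllOne X) (α : ℝ) (hα : α ∈ Set.Ioo (0 : ℝ) 1) :
    ∃ T : Metric.closedBall (0 : X) 1 → Metric.closedBall (0 : X) 1,
      UniformlyHolderNonexpansive α T ∧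
        Function.fixedPoints T = ∅ ∧
        minimalDisplacement T = 0 := by
  obtain ⟨e, Q, hQe⟩ := hX.exists_leftInverse
  obtain ⟨δ, hδ0, hδ1, hδ⟩ := exists_pos_rpow_mul_rpow_le_one (L := ‖e‖ * 4 * ‖Q‖) hα
    (by positivity)
  have hA : 0 < 2 * (‖e‖ + 1) := by positivity
  -- Makes the image of the sphere under `c • e` have diameter at most `δ` and lie in the unit ball.
  set c : ℝ := δ / (2 * (‖e‖ + 1)) with hc
  have hc0 : 0 < c := by positivity
  have hce : 2 * (c * ‖e‖) ≤ δ := by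
    have : c * (2 * (‖e‖ + 1)) = δ := div_mul_cancel₀ _ hA.ne'
    linarith
  have hsph : ∀ {w : lp (fun _ : ℕ => ℝ) 1}, ‖w‖ = 1 → ‖c • e w‖ ≤ c * ‖e‖ := by
    intro w hw
    rw [norm_smul, Real.norm_of_nonneg hc0.le]
    gcongr
    simpa [hw] using e.le_opNorm w
  have hmem : ∀ {w : lp (fun _ : ℕ => ℝ) 1}, ‖w‖ = 1 → c • e w ∈ Metric.closedBall (0 : X) 1 := by
    intro w hw
    rw [mem_closedBall_zero_iff]
    linarith [hsph hw, norm_nonneg (c • e w)]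
  have hret : ∀ w, c⁻¹ • Q (c • e w) = w := by
    intro w
    rw [map_smul, hQe, inv_smul_smul₀ hc0.ne']
  let T : Metric.closedBall (0 : X) 1 → Metric.closedBall (0 : X) 1 := fun x =>
    ⟨c • e (sphereShift (c⁻¹ • Q x)), hmem (norm_sphereShift _)⟩
  -- Between successive applications `c⁻¹ • Q` cancels `c • e`, so the norms of `e` and `Q` enter
  -- only once.
  have hT : ∀ (n : ℕ) (x : Metric.closedBall (0 : X) 1),
      (T^[n + 1] x : X) = c • e (sphereShift^[n + 1] (c⁻¹ • Q x)) := by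
    intro n x
    induction n with
    | zero => rfl
    | succ n ih =>
      rw [Function.iterate_succ_apply' T, Function.iterate_succ_apply' sphereShift (n + 1)]
      change c • e (sphereShift (c⁻¹ • Q (T^[n + 1] x : X))) = _
      rw [ih, hret]
  refine ⟨T, ?_, ?_, ?_⟩
  · intro n hn x y
    obtain ⟨n, rfl⟩ := Nat.exists_eq_add_of_le' hn
    refine le_rpow_of_le_mul_of_le (L := ‖e‖ * 4 * ‖Q‖) hα dist_nonneg dist_nonneg
      (by positivity) ?_ ?_ hδ
    · rw [Subtype.dist_eq, Subtype.dist_eq, hT, hT, dist_eq_norm, dist_eq_norm, ← smul_sub,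
        ← map_sub, norm_smul, Real.norm_of_nonneg hc0.le]
      have hlip := norm_iterate_sphereShift_sub_le n (c⁻¹ • Q (x : X)) (c⁻¹ • Q (y : X))
      rw [← smul_sub, ← map_sub, norm_smul, norm_inv, Real.norm_of_nonneg hc0.le] at hlip
      calc c * ‖e (sphereShift^[n + 1] (c⁻¹ • Q (x : X)) - sphereShift^[n + 1] (c⁻¹ • Q (y : X)))‖
          ≤ c * (‖e‖ * (4 * (c⁻¹ * (‖Q‖ * ‖(x - y : X)‖)))) := by
            gcongr
            refine (e.le_opNorm _).trans ?_
            gcongr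
            refine hlip.trans ?_
            gcongr
            exact Q.le_opNorm _
        _ = ‖e‖ * 4 * ‖Q‖ * ‖(x - y : X)‖ := by field_simp
    · rw [Subtype.dist_eq, hT, hT, dist_eq_norm]
      refine (norm_sub_le _ _).trans ?_
      linarith [hsph (norm_iterate_sphereShift n (c⁻¹ • Q (x : X))),
        hsph (norm_iterate_sphereShift n (c⁻¹ • Q (y : X)))]
  · refine Set.eq_empty_of_forall_notMem fun x hx => sphereShift_ne_self (c⁻¹ • Q (x : X)) ?_
    have hx' : c • e (sphereShift (c⁻¹ • Q (x : X))) = x := congrArg Subtype.val hx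
    conv_rhs => rw [← hx', hret]
  · have hbdd : BddBelow (Set.range fun x => dist x (T x)) :=
      ⟨0, by rintro _ ⟨x, rfl⟩; exact dist_nonneg⟩
    refine le_antisymm (le_of_forall_pos_le_add fun ε hε => ?_)
      (Real.iInf_nonneg fun x => dist_nonneg)
    obtain ⟨w, hw, hwε⟩ := exists_norm_sphereShift_sub_le hε
    refine (ciInf_le hbdd ⟨c • e w, hmem hw⟩).trans ?_
    rw [zero_add, Subtype.dist_eq]
    change dist (c • e w) (c • e (sphereShift (c⁻¹ • Q (c • e w)))) ≤ ε
    rw [hret, dist_comm, dist_eq_norm, ← smul_sub, ← map_sub, norm_smul,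
      Real.norm_of_nonneg hc0.le]
    calc c * ‖e (sphereShift w - w)‖ ≤ c * (‖e‖ * ε) := by
          gcongr
          exact e.le_opNorm_of_le hwε
      _ = c * ‖e‖ * ε := by ring
      _ ≤ 1 * ε := by
          gcongr
          linarith [norm_nonneg (c • e w), hsph hw]
      _ = ε := one_mul ε
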